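/- Let $\mathbb{F}$ be a field of characteristic different from $2$ and $3$. Let $\mathbb{O}$ be the $8$-dimensional octonion algebra over $\mathbb{F}$ with basis $1,i_0,\dots,i_6$ (subscripts modulo $7$), where $1$ is the identity, $i_t^2=-1$, and for every $t$ the elements $i_t,i_{t+1},i_{t+3}$ multiply like the quaternion units $i,j,k$ (so $ij=k=-ji$, $jk=i=-kj$, $ki=j=-ik$). Let $\overline{\phantom{x}}$ be the linear map on $\mathbb{O}$ that fixes $1$ and negates every $i_t$. The Albert algebra $A(\mathbb{F})$ is the space of $3\times 3$ Hermitian matrices $X$ over $\mathbb{O}$ (that is, $X^T=\overline{X}$) with the commutative product $X\circ Y=\frac12(XY+YX)$, written $XY$ from here on. For $d,e,f\in\mathbb{F}$ and $D,E,F\in\mathbb{O}$ write $$(d,e,f\mid D,E,F)=\begin{pmatrix} d & F & \overline{E}\\ \overline{F} & e & D\\ E & \overline{D} & f\end{pmatrix}.$$ For a commutative $\mathbb{F}$-algebra $A$, $a\in A$ and $\lambda\in\mathbb{F}$, let $A_\lambda(a)=\{x\in A : ax=\lambda x\}$. An axis is an idempotent $a$ for which $x\mapsto ax$ is semisimple;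 it is primitive if $A_1(a)$ is one-dimensional, i.e. spanned by $a$. Let $\eta\in\mathbb{F}\setminus\{0,1\}$. An axis $a$ satisfies the fusion rules of Jordan type $\eta$ if $A=A_1(a)\oplus A_0(a)\oplus A_\eta(a)$, $A_0(a)^2\subseteq A_0(a)$, and $A_\delta(a)A_\epsilon(a)\subseteq A_{\delta\epsilon}(a)$ for all $\delta,\epsilon\in\{+,-\}$, where $A_+(a)=A_1(a)\oplus A_0(a)$ and $A_-(a)=A_\eta(a)$. The algebra $A$ is a primitive axial algebra of Jordan type $\eta$ if it is generated by a set of primitive axes satisfying the fusion rules of Jordan type $\eta$. Let $$a=\tfrac12(1,1,0\mid 0,0,i_0),\quad b=\tfrac12(1,0,1\mid 0,i_1,0),\quad c=\tfrac12(0,1,1\mid i_2,0,0),\quad d=\tfrac19(1,4,4\mid 4i_4,2i_3,2i_6).$$ Then the following hold. 1. $\dim_{\mathbb{F}}A(\mathbb{F})=27$. 2. Each of $a,b,c,d$ is an idempotent of $A(\mathbb{F})$ whose trace (the sum of its diagonal entries) is $1$. 3. Each of $a,b,c,d$ is a primitive axis satisfying the fusion rules of Jordan type $\frac12$, and $a,b,c,d$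 generate $A(\mathbb{F})$. In particular, $A(\mathbb{F})$ is a primitive axial algebra of Jordan type $\frac12$. 4. The following $27$ elements form a basis of $A(\mathbb{F})$: $a$, $b$, $c$, $d$, $ab$, $ac$, $ad$, $bc$, $bd$, $cd$, $a(bc)$, $b(ac)$, $c(ab)$, $a(bd)$, $a(cd)$, $b(ad)$, $b(cd)$, $c(ad)$, $c(bd)$, $(ab)(cd)$, $(ac)(bd)$, $d(a(bc))$, $d(b(ac))$, $a(b(cd))$, $(ab)(c(ad))$, $(ab)(c(bd))$, $(ac)(b(cd))$. -/

import Mathlib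

/-! ### Axial algebras of Jordan type -/

namespace Axial

variable (F : Type*) {A : Type*} [Field F] [NonUnitalNonAssocCommRing A] [Module F A]
  [IsScalarTower F A A] [SMulCommClass F A A]

/-- The eigenspace `A_μ(a)` of the adjoint operator `ad_a : x ↦ a * x`. -/
def adEigenspace (a : A) (μ : F) : Submodule F A :=
  Module.End.eigenspace (LinearMap.mulLeft F a) μ

/-- An axis: an idempotent whose adjoint operator is semisimple. -/
structure IsAxis (a : A) : Prop where
  idempotent : a * a = a
  semisimple : Module.End.IsSemisimple (LinearMap.mulLeft F a)

/-- A primitive axis: `A_1(a)` is one-dimensional, i.e. spanned by `a`. -/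
structure IsPrimitiveAxis (a : A) : Prop extends IsAxis F a where
  ne_zero : a ≠ 0
  eigenspace_one : adEigenspace F a 1 = Submodule.span F {a}

/-- The even part `A_+(a) = A_1(a) + A_0(a)`. -/
def evenPart (a : A) : Submodule F A :=
  adEigenspace F a 1 ⊔ adEigenspace F a 0

variable {F}

/-- The odd part `A_-(a) = A_η(a)`. -/
def oddPart (η : F) (a : A) : Submodule F A :=
  adEigenspace F a η

/-- The decomposition `A = A_1(a) ⊕ A_0(a) ⊕ A_η(a)` together with the fusion rules
of Jordan type `η`. -/
structure HasJordanTypeFusion (η : F) (a : A) : Prop where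
  decomposition : DirectSum.IsInternal
    ![adEigenspace F a 1, adEigenspace F a 0, adEigenspace F a η]
  zero_zero : ∀ x ∈ adEigenspace F a 0, ∀ y ∈ adEigenspace F a 0, x * y ∈ adEigenspace F a 0
  even_even : ∀ x ∈ evenPart F a, ∀ y ∈ evenPart F a, x * y ∈ evenPart F a
  even_odd : ∀ x ∈ evenPart F a, ∀ y ∈ oddPart η a, x * y ∈ oddPart η a
  odd_even : ∀ x ∈ oddPart η a, ∀ y ∈ evenPart F a, x * y ∈ oddPart η a
  odd_odd : ∀ x ∈ oddPart η a, ∀ y ∈ oddPart η a, x * y ∈ evenPart F a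

/-- `S` is a set of primitive axes that satisfy the fusion rules of Jordan type `η` and
generate the commutative algebra `A`. -/
structure IsGeneratingAxes (η : F) (S : Set A) : Prop where
  eta_ne_zero : η ≠ 0
  eta_ne_one : η ≠ 1
  primitive : ∀ a ∈ S, IsPrimitiveAxis F a
  fusion : ∀ a ∈ S, HasJordanTypeFusion η a
  generates : NonUnitalAlgebra.adjoin F S = ⊤

variable (A) in
/-- `A` is a primitive axial algebra of Jordan type `η`. -/
def IsPrimitiveAxialAlgebra (η : F) : Prop :=
  ∃ S : Set A, IsGeneratingAxes η S

end Axial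

/-! ### Octonions -/

/-- The octonion `re + ∑ t, im t • i_t`, where `t` runs over the residues modulo `7`. -/
@[ext]
structure Octonion (F : Type*) where
  re : F
  im : Fin 7 → F

namespace Octonion

variable {F : Type*} [Field F]

instance : Zero (Octonion F) := ⟨⟨0, 0⟩⟩
instance : One (Octonion F) := ⟨⟨1, 0⟩⟩
instance : Add (Octonion F) := ⟨fun x y => ⟨x.re + y.re, x.im + y.im⟩⟩
instance : Neg (Octonion F) := ⟨fun x => ⟨-x.re, -x.im⟩⟩
instance : SMul F (Octonion F) := ⟨fun c x => ⟨c * x.re, c • x.im⟩⟩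

/-- The bilinear product in which `1` is the identity, `i_t * i_t = -1`, and for each `s` modulo `7`
the elements `i_s`, `i_{s+1}`, `i_{s+3}` multiply like the quaternions `i`, `j`, `k`.
The coefficient of `i_t` collects the three ways in which `i_t` is a product of two other
imaginary units: as `i_{s+3} = i_s i_{s+1}` with `s = t - 3 = t + 4`,
as `i_s = i_{s+1} i_{s+3}` with `s = t`, and
as `i_{s+1} = i_{s+3} i_s` with `s = t - 1 = t + 6`. -/
instance : Mul (Octonion F) := ⟨fun x y =>
  ⟨x.re * y.re - ∑ t, x.im t * y.im t,
   fun t => x.re * y.im t + x.im t * y.re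
     + (x.im (t + 4) * y.im (t + 5) - x.im (t + 5) * y.im (t + 4))
     + (x.im (t + 1) * y.im (t + 3) - x.im (t + 3) * y.im (t + 1))
     + (x.im (t + 2) * y.im (t + 6) - x.im (t + 6) * y.im (t + 2))⟩⟩

/-- Octonion conjugation: it fixes `1` and negates every `i_t`. -/
instance : Star (Octonion F) := ⟨fun x => ⟨x.re, -x.im⟩⟩

@[simp] theorem re_zero : (0 : Octonion F).re = 0 := rfl
@[simp] theorem im_zero : (0 : Octonion F).im = 0 := rfl
@[simp] theorem re_one : (1 : Octonion F).re = 1 := rfl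
@[simp] theorem im_one : (1 : Octonion F).im = 0 := rfl
@[simp] theorem re_add (x y : Octonion F) : (x + y).re = x.re + y.re := rfl
@[simp] theorem im_add (x y : Octonion F) : (x + y).im = x.im + y.im := rfl
@[simp] theorem re_neg (x : Octonion F) : (-x).re = -x.re := rfl
@[simp] theorem im_neg (x : Octonion F) : (-x).im = -x.im := rfl
@[simp] theorem re_smul (c : F) (x : Octonion F) : (c • x).re = c * x.re := rfl
@[simp] theorem im_smul (c : F) (x : Octonion F) : (c • x).im = c • x.im := rfl
@[simp] theorem re_star (x : Octonion F) : (star x).re = x.re := rfl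
@[simp] theorem im_star (x : Octonion F) : (star x).im = -x.im := rfl
@[simp] theorem re_mul (x y : Octonion F) :
    (x * y).re = x.re * y.re - ∑ t, x.im t * y.im t := rfl
@[simp] theorem im_mul (x y : Octonion F) (t : Fin 7) :
    (x * y).im t = x.re * y.im t + x.im t * y.re
     + (x.im (t + 4) * y.im (t + 5) - x.im (t + 5) * y.im (t + 4))
     + (x.im (t + 1) * y.im (t + 3) - x.im (t + 3) * y.im (t + 1))
     + (x.im (t + 2) * y.im (t + 6) - x.im (t + 6) * y.im (t + 2)) := rfl

instance : AddCommGroup (Octonion F) where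
  add_assoc x y z := by ext <;> simp [add_assoc]
  zero_add x := by ext <;> simp
  add_zero x := by ext <;> simp
  add_comm x y := by ext <;> simp [add_comm]
  neg_add_cancel x := by ext <;> simp
  nsmul := nsmulRec
  zsmul := zsmulRec

instance : NonAssocRing (Octonion F) where
  left_distrib x y z := by
    ext <;> simp [mul_add, Finset.sum_add_distrib] <;> ring
  right_distrib x y z := by
    ext <;> simp [add_mul, Finset.sum_add_distrib] <;> ring
  zero_mul x := by ext <;> simp
  mul_zero x := by ext <;> simp
  one_mul x := by ext <;> simp
  mul_one x := by ext <;> simp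

instance : Module F (Octonion F) where
  one_smul x := by ext <;> simp
  mul_smul c d x := by ext <;> simp [mul_assoc]
  smul_zero c := by ext <;> simp
  smul_add c x y := by ext <;> simp [mul_add]
  add_smul c d x := by ext <;> simp [add_mul]
  zero_smul x := by ext <;> simp

instance : IsScalarTower F (Octonion F) (Octonion F) where
  smul_assoc c x y := by
    ext
    · simp [mul_sub, Finset.mul_sum, mul_assoc]
    · simp; ring

instance : SMulCommClass F (Octonion F) (Octonion F) where
  smul_comm c x y := by
    ext
    · simp [mul_sub, Finset.mul_sum, mul_left_comm]
    · simp; ring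

instance : StarRing (Octonion F) where
  star_involutive x := by ext <;> simp
  star_mul x y := by
    ext
    · simp [mul_comm]
    · simp; ring
  star_add x y := by ext <;> simp [add_comm]

theorem star_smul' (c : F) (x : Octonion F) : star (c • x) = c • star x := by
  ext <;> simp

/-- The imaginary unit `i_t`. -/
def i (t : Fin 7) : Octonion F := ⟨0, Pi.single t 1⟩

/-- The embedding of the field as the multiples of `1`. -/
def ofField (c : F) : Octonion F := ⟨c, 0⟩

theorem star_ofField (c : F) : star (ofField c) = ofField c := by
  ext <;> simp [ofField]

end Octonion

/-! ### The Albert algebra -/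

/-- The space of Hermitian `3 × 3` matrices over the octonions. -/
def hermitianOctonionMatrices (F : Type*) [Field F] :
    Submodule F (Matrix (Fin 3) (Fin 3) (Octonion F)) where
  carrier := {X | X.IsHermitian}
  zero_mem' := Matrix.isHermitian_zero
  add_mem' hX hY := hX.add hY
  smul_mem' c X hX := by
    ext1 j k
    rw [Matrix.conjTranspose_apply, Matrix.smul_apply, Matrix.smul_apply, Octonion.star_smul',
      hX.apply]

/-- The Albert algebra: Hermitian `3 × 3` octonion matrices with the product
`X ∘ Y = (1/2)(XY + YX)`, written `X * Y`. -/
def AlbertAlgebra (F : Type*) [Field F] : Type _ := hermitianOctonionMatrices F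

namespace AlbertAlgebra

variable {F : Type*} [Field F]

instance : AddCommGroup (AlbertAlgebra F) :=
  inferInstanceAs (AddCommGroup (hermitianOctonionMatrices F))

instance : Module F (AlbertAlgebra F) :=
  inferInstanceAs (Module F (hermitianOctonionMatrices F))

/-- The underlying octonion matrix. -/
def toMatrix : AlbertAlgebra F →ₗ[F] Matrix (Fin 3) (Fin 3) (Octonion F) :=
  (hermitianOctonionMatrices F).subtype

theorem toMatrix_injective : Function.Injective (toMatrix (F := F)) :=
  Subtype.val_injective

theorem isHermitian_toMatrix (X : AlbertAlgebra F) : (toMatrix X).IsHermitian := X.2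

theorem jordan_mem (X Y : AlbertAlgebra F) :
    (2 : F)⁻¹ • (toMatrix X * toMatrix Y + toMatrix Y * toMatrix X)
      ∈ hermitianOctonionMatrices F := by
  apply Submodule.smul_mem
  change Matrix.conjTranspose _ = _
  rw [Matrix.conjTranspose_add, Matrix.conjTranspose_mul, Matrix.conjTranspose_mul,
    (isHermitian_toMatrix X).eq, (isHermitian_toMatrix Y).eq, add_comm]

instance : Mul (AlbertAlgebra F) :=
  ⟨fun X Y => ⟨(2 : F)⁻¹ • (toMatrix X * toMatrix Y + toMatrix Y * toMatrix X), jordan_mem X Y⟩⟩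

theorem toMatrix_mul (X Y : AlbertAlgebra F) :
    toMatrix (X * Y) = (2 : F)⁻¹ • (toMatrix X * toMatrix Y + toMatrix Y * toMatrix X) := rfl

instance : NonUnitalNonAssocCommRing (AlbertAlgebra F) where
  left_distrib X Y Z := toMatrix_injective <| by
    simp only [toMatrix_mul, map_add, mul_add, add_mul, ← smul_add]
    congr 1; abel
  right_distrib X Y Z := toMatrix_injective <| by
    simp only [toMatrix_mul, map_add, mul_add, add_mul, ← smul_add]
    congr 1; abel
  zero_mul X := toMatrix_injective <| by simp [toMatrix_mul]
  mul_zero X := toMatrix_injective <| by simp [toMatrix_mul]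
  mul_comm X Y := toMatrix_injective <| by simp only [toMatrix_mul, add_comm]

instance : IsScalarTower F (AlbertAlgebra F) (AlbertAlgebra F) where
  smul_assoc c X Y := toMatrix_injective <| by
    simp only [smul_eq_mul, toMatrix_mul, map_smul, Matrix.smul_mul, Matrix.mul_smul, ← smul_add]
    rw [smul_comm]

instance : SMulCommClass F (AlbertAlgebra F) (AlbertAlgebra F) where
  smul_comm c X Y := toMatrix_injective <| by
    simp only [smul_eq_mul, toMatrix_mul, map_smul, Matrix.smul_mul, Matrix.mul_smul, ← smul_add]
    rw [smul_comm]

/-- The Hermitian matrix `(d, e, f | D, E, F)`, with `x`, `y`, `z` for the capital letters. -/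
def mk (d e f : F) (x y z : Octonion F) : AlbertAlgebra F :=
  ⟨!![Octonion.ofField d, z, star y;
      star z, Octonion.ofField e, x;
      y, star x, Octonion.ofField f], by
    change Matrix.conjTranspose _ = _
    ext1 j k
    fin_cases j <;> fin_cases k <;> simp [Octonion.star_ofField]⟩

/-- The trace, i.e. the sum of the diagonal entries. -/
def trace (X : AlbertAlgebra F) : Octonion F := (toMatrix X).trace

open Octonion (i)

variable (F) in
/-- `a = (1/2)(1, 1, 0 | 0, 0, i₀)`. -/
def axisA : AlbertAlgebra F := (1 / 2 : F) • mk 1 1 0 0 0 (i 0)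

variable (F) in
/-- `b = (1/2)(1, 0, 1 | 0, i₁, 0)`. -/
def axisB : AlbertAlgebra F := (1 / 2 : F) • mk 1 0 1 0 (i 1) 0

variable (F) in
/-- `c = (1/2)(0, 1, 1 | i₂, 0, 0)`. -/
def axisC : AlbertAlgebra F := (1 / 2 : F) • mk 0 1 1 (i 2) 0 0

variable (F) in
/-- `d = (1/9)(1, 4, 4 | 4i₄, 2i₃, 2i₆)`. -/
def axisD : AlbertAlgebra F :=
  (1 / 9 : F) • mk 1 4 4 ((4 : F) • i 4) ((2 : F) • i 3) ((2 : F) • i 6)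

/-- The 27 products of `a`, `b`, `c`, `d`. -/
def products (a b c d : AlbertAlgebra F) : Fin 27 → AlbertAlgebra F :=
  ![a, b, c, d,
    a * b, a * c, a * d, b * c, b * d, c * d,
    a * (b * c), b * (a * c), c * (a * b), a * (b * d), a * (c * d), b * (a * d), b * (c * d),
    c * (a * d), c * (b * d),
    (a * b) * (c * d), (a * c) * (b * d), d * (a * (b * c)), d * (b * (a * c)),
    a * (b * (c * d)),
    (a * b) * (c * (a * d)), (a * b) * (c * (b * d)), (a * c) * (b * (c * d))]

end AlbertAlgebra

/-! Each of the four idempotents `e` has rank one: `U_e x = 2 e (e x) - e x` always lies on the line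
`F e`. This property and the Peirce multiplication rules give all that is required of an axis. The
equation `U_e x = r e` splits `x` explicitly into eigenvectors for `1`, `0` and `1/2`, it forces the
`1`-eigenspace to be `F e`, and the Peirce rules become the fusion rules (`hasJordanTypeFusion`).

Rank one is proved for `s⁻¹ v vᵀ`, where `v` has entries in the field and `s = vᵀ v ≠ 0`
(`isRankOneIdempotent_of_toMatrix_eq`). A matrix over the field associates with all octonion
matrices, so the Peirce calculus of associative algebras applies despite the nonassociative entries.
The axes are brought to this form by automorphisms: the cyclic shift `rotate`, and `twist u` for an
octonion `u` of norm one, which is multiplicative by the Moufang identities (`twist_mul`).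

For the basis, the 27 products are scaled by powers of 2, times 9 when `d` occurs, so that their
coordinates become integers independent of the field. The resulting integral matrix has an inverse
with denominators dividing 16 (`productCoordinatesInverse_mul`), so its rows are independent as soon
as `2 ≠ 0`. Since the dimension is 27, the products form a basis, and therefore the axes generate.
-/

namespace Axial

/-! ### Rank one idempotents and the fusion rules of Jordan type 1/2. -/

variable (F : Type*) {A : Type*} [Field F] [NonUnitalNonAssocCommRing A] [Module F A]

/-- A nonzero idempotent `e` with `U_e x ∈ F e` for all `x` that satisfies the Peirce multiplication
rules. Here `U_e x = 2 e (e x) - e x`, and `e x + e x = x` says that `x` lies in the Peirce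
`1/2`-space. -/
structure IsRankOneIdempotent (e : A) : Prop where
  ne_zero : e ≠ 0
  idempotent : e * e = e
  quadratic : ∀ x, ∃ r : F, e * (e * x) + e * (e * x) - e * x = r • e
  zero_zero : ∀ x y, e * x = 0 → e * y = 0 → e * (x * y) = 0
  zero_half : ∀ x y, e * x = 0 → e * y + e * y = y → e * (x * y) + e * (x * y) = x * y
  half_half : ∀ x y, e * x + e * x = x → e * y + e * y = y → e * (e * (x * y)) = e * (x * y)

namespace IsRankOneIdempotent

variable {F} {e : A}

/-- Every condition is an equation or an implication between equations, so it pulls back along any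
multiplicative embedding; surjectivity plays no role. -/
theorem of_map {B : Type*} [NonUnitalNonAssocCommRing B] [Module F B] (φ : A →ₗ[F] B)
    (hφ : Function.Injective φ) (hmul : ∀ x y, φ (x * y) = φ x * φ y)
    (h : IsRankOneIdempotent F (φ e)) : IsRankOneIdempotent F e where
  ne_zero := fun h0 => h.ne_zero (by rw [h0, map_zero])
  idempotent := hφ (by rw [hmul, h.idempotent])
  quadratic x := by
    obtain ⟨r, hr⟩ := h.quadratic (φ x)
    exact ⟨r, hφ (by simpa only [map_sub, map_add, map_smul, hmul] using hr)⟩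
  zero_zero x y hx hy := hφ (by
    simpa only [map_zero, hmul] using h.zero_zero (φ x) (φ y)
      (by rw [← hmul, hx, map_zero]) (by rw [← hmul, hy, map_zero]))
  zero_half x y hx hy := hφ (by
    simpa only [map_add, hmul] using h.zero_half (φ x) (φ y)
      (by rw [← hmul, hx, map_zero]) (by rw [← hmul, ← map_add, hy]))
  half_half x y hx hy := hφ (by
    simpa only [hmul] using h.half_half (φ x) (φ y)
      (by rw [← hmul, ← map_add, hx]) (by rw [← hmul, ← map_add, hy]))

variable [SMulCommClass F A A]

theorem mem_adEigenspace {a : A} {μ : F} {x : A} : x ∈ adEigenspace F a μ ↔ a * x = μ • x := by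
  rw [adEigenspace, Module.End.mem_eigenspace_iff, LinearMap.mulLeft_apply]

theorem mem_adEigenspace_zero {a x : A} : x ∈ adEigenspace F a 0 ↔ a * x = 0 := by
  rw [mem_adEigenspace, zero_smul]

theorem mem_adEigenspace_half (h2 : (2 : F) ≠ 0) {a x : A} :
    x ∈ adEigenspace F a (1 / 2 : F) ↔ a * x + a * x = x := by
  rw [mem_adEigenspace, ← two_smul F (a * x), one_div, eq_inv_smul_iff₀ h2]

theorem adEigenspace_one (h : IsRankOneIdempotent F e) :
    adEigenspace F e 1 = Submodule.span F {e} := by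
  ext x
  rw [mem_adEigenspace, one_smul, Submodule.mem_span_singleton]
  constructor
  · intro hx
    obtain ⟨r, hr⟩ := h.quadratic x
    exact ⟨r, by rw [← hr, hx, hx, add_sub_cancel_right]⟩
  · rintro ⟨r, rfl⟩
    rw [mul_smul_comm, h.idempotent]

theorem mem_evenPart (h : IsRankOneIdempotent F e) {x : A} :
    x ∈ evenPart F e ↔ ∃ r : F, ∃ y, e * y = 0 ∧ x = r • e + y := by
  rw [evenPart, h.adEigenspace_one, Submodule.mem_sup]
  constructor
  · rintro ⟨_, hz, y, hy, rfl⟩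
    obtain ⟨r, rfl⟩ := Submodule.mem_span_singleton.1 hz
    exact ⟨r, y, mem_adEigenspace_zero.1 hy, rfl⟩
  · rintro ⟨r, y, hy, rfl⟩
    exact ⟨_, Submodule.smul_mem _ r (Submodule.mem_span_singleton_self e), y,
      mem_adEigenspace_zero.2 hy, rfl⟩

/-- Rank one gives `2 e (e x) = r e + e x`. Hence `z = 2 e x - 2 r e` satisfies `2 e z = z`, and `e`
annihilates `x - r e - z`. No division by 2 occurs. -/
theorem exists_peirce_decomposition (h : IsRankOneIdempotent F e) (x : A) :
    ∃ r : F, ∃ y z, e * y = 0 ∧ e * z + e * z = z ∧ x = r • e + y + z := by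
  obtain ⟨r, hr⟩ := h.quadratic x
  have hex : e * (e * x) + e * (e * x) = r • e + e * x := by rw [← hr]; abel
  refine ⟨r, x - r • e - (e * x + e * x - (r • e + r • e)), e * x + e * x - (r • e + r • e),
    ?_, ?_, by abel⟩
  · simp only [mul_sub, mul_add, mul_smul_comm, h.idempotent, hex]
    abel
  · simp only [mul_sub, mul_add, mul_smul_comm, h.idempotent, hex]
    abel

theorem iSup_adEigenspace (h : IsRankOneIdempotent F e) (h2 : (2 : F) ≠ 0) :
    ⨆ k, ![adEigenspace F e 1, adEigenspace F e 0, adEigenspace F e (1 / 2 : F)] k = ⊤ := by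
  refine eq_top_iff.2 fun x _ => ?_
  obtain ⟨r, y, z, hy, hz, rfl⟩ := h.exists_peirce_decomposition x
  set V := ![adEigenspace F e 1, adEigenspace F e 0, adEigenspace F e (1 / 2 : F)] with hV
  refine Submodule.add_mem _ (Submodule.add_mem _ ?_ ?_) ?_
  · refine Submodule.mem_iSup_of_mem (p := V) 0 ?_
    change r • e ∈ adEigenspace F e 1
    rw [h.adEigenspace_one]
    exact Submodule.smul_mem _ r (Submodule.mem_span_singleton_self e)
  · exact Submodule.mem_iSup_of_mem (p := V) 1 (mem_adEigenspace_zero.2 hy)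
  · exact Submodule.mem_iSup_of_mem (p := V) 2 ((mem_adEigenspace_half h2).2 hz)

theorem isInternal_adEigenspace (h : IsRankOneIdempotent F e) (h2 : (2 : F) ≠ 0) :
    DirectSum.IsInternal
      ![adEigenspace F e 1, adEigenspace F e 0, adEigenspace F e (1 / 2 : F)] := by
  rw [DirectSum.isInternal_submodule_iff_iSupIndep_and_iSup_eq_top]
  refine ⟨?_, h.iSup_adEigenspace h2⟩
  have hinj : Function.Injective ![(1 : F), 0, 1 / 2] := by
    have h21 : (2 : F)⁻¹ ≠ 1 := fun h => by
      have : (2 : F) = 1 := inv_eq_one.1 h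
      exact one_ne_zero (α := F) (by linear_combination this)
    intro j k hjk
    fin_cases j <;> fin_cases k <;> simp [h2, h21, h21.symm, h2.symm] at hjk ⊢
  convert (Module.End.eigenspaces_iSupIndep (LinearMap.mulLeft F e)).comp hinj using 1
  funext k
  fin_cases k <;> rfl

theorem isSemisimple_mulLeft (h : IsRankOneIdempotent F e) :
    Module.End.IsSemisimple (LinearMap.mulLeft F e) := by
  open Polynomial in
  refine Module.End.isSemisimple_of_squarefree_aeval_eq_zero
    (p := X * (X - 1) * (X + X - 1)) (Polynomial.Separable.squarefree ?_) ?_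
  -- The polynomial `X (X - 1) (2 X - 1)` has discriminant 1, so the Bézout coefficients for it and
  -- its derivative are integers, valid in every characteristic.
  · refine ⟨-36 * X + 18, 12 * X ^ 2 - 12 * X + 1, ?_⟩
    simp only [derivative_mul, derivative_sub, derivative_add, derivative_X, derivative_one]
    ring
  · ext x
    obtain ⟨r, y, z, hy, hz, rfl⟩ := h.exists_peirce_decomposition x
    have hz' : e * (e * (e * z)) + e * (e * (e * z)) = e * (e * z) := by
      rw [← mul_add, ← mul_add, hz]
    have hz'' : e * (e * z) + e * (e * z) = e * z := by rw [← mul_add, hz]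
    simp only [LinearMap.zero_apply, map_mul, map_sub, map_add, aeval_X, map_one,
      Module.End.mul_apply, LinearMap.sub_apply, LinearMap.add_apply, LinearMap.mulLeft_apply,
      Module.End.one_apply, h.idempotent, hy, mul_add, mul_sub, mul_smul_comm, mul_zero]
    linear_combination (norm := abel) hz' - hz''

theorem isPrimitiveAxis (h : IsRankOneIdempotent F e) :
    IsPrimitiveAxis F e where
  idempotent := h.idempotent
  semisimple := h.isSemisimple_mulLeft
  ne_zero := h.ne_zero
  eigenspace_one := h.adEigenspace_one

variable [IsScalarTower F A A] in
theorem hasJordanTypeFusion (h : IsRankOneIdempotent F e) (h2 : (2 : F) ≠ 0) :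
    HasJordanTypeFusion (1 / 2 : F) e := by
  have even_odd : ∀ x ∈ evenPart F e, ∀ y ∈ oddPart (1 / 2 : F) e,
      x * y ∈ oddPart (1 / 2 : F) e := by
    intro x hx y hy
    obtain ⟨r, x, hx', rfl⟩ := h.mem_evenPart.1 hx
    have hy' := (mem_adEigenspace_half h2).1 hy
    have hey : e * y ∈ adEigenspace F e (1 / 2 : F) := by
      rw [mem_adEigenspace_half h2, ← mul_add, hy']
    rw [add_mul, smul_mul_assoc]
    exact Submodule.add_mem _ (Submodule.smul_mem _ r hey)
      ((mem_adEigenspace_half h2).2 (h.zero_half x y hx' hy'))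
  refine ⟨h.isInternal_adEigenspace h2, ?_, ?_, even_odd, ?_, ?_⟩
  · intro x hx y hy
    rw [mem_adEigenspace_zero] at *
    exact h.zero_zero x y hx hy
  · intro x hx y hy
    obtain ⟨r, x, hx', rfl⟩ := h.mem_evenPart.1 hx
    obtain ⟨s, y, hy', rfl⟩ := h.mem_evenPart.1 hy
    refine h.mem_evenPart.2 ⟨s * r, x * y, h.zero_zero x y hx' hy', ?_⟩
    simp only [add_mul, mul_add, smul_mul_assoc, mul_smul_comm, h.idempotent, hy',
      mul_comm x e, hx', smul_zero, add_zero, zero_add, mul_smul]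
  · intro x hx y hy
    rw [mul_comm]
    exact even_odd y hy x hx
  · intro x hx y hy
    have hxy := h.half_half x y ((mem_adEigenspace_half h2).1 hx) ((mem_adEigenspace_half h2).1 hy)
    -- As `e` fixes `e (x y)`, the summands `e (x y)` and `x y - e (x y)` are the components for the
    -- eigenvalues 1 and 0.
    rw [← add_sub_cancel (e * (x * y)) (x * y)]
    refine Submodule.add_mem_sup ?_ ?_
    · rw [mem_adEigenspace, hxy, one_smul]
    · rw [mem_adEigenspace_zero, mul_sub, hxy, sub_self]

end IsRankOneIdempotent

end Axial

/-! ### Norm and Moufang identities for octonions. -/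

namespace Octonion

variable {F : Type*} [Field F]

/-- The polarized norm form `Re (x * star y)`. -/
def normForm (x y : Octonion F) : F := x.re * y.re + ∑ t, x.im t * y.im t

theorem ofField_mul (c : F) (x : Octonion F) : ofField c * x = c • x := by
  ext <;> simp [ofField]

theorem mul_ofField (c : F) (x : Octonion F) : x * ofField c = c • x := by
  ext <;> simp [ofField, mul_comm]

theorem ofField_add (c d : F) : ofField (c + d) = ofField c + ofField d := by
  ext <;> simp [ofField]

theorem ofField_eq_smul_one (c : F) : ofField c = c • (1 : Octonion F) := by
  ext <;> simp [ofField]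

theorem smul_ofField (c d : F) : c • ofField d = ofField (c * d) := by
  ext <;> simp [ofField]

theorem mul_star_add_mul_star (x y : Octonion F) :
    x * star y + y * star x = ofField (2 * normForm x y) := by
  ext
  · simp [ofField, normForm, mul_comm]; ring
  · simp [ofField]; ring

theorem star_mul_add_star_mul (x y : Octonion F) :
    star x * y + star y * x = ofField (2 * normForm x y) := by
  ext
  · simp [ofField, normForm, mul_comm]; ring
  · simp [ofField]; ring

theorem eq_ofField_of_star_eq (h2 : (2 : F) ≠ 0) {x : Octonion F} (hx : star x = x) :
    x = ofField x.re := by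
  ext t
  · rfl
  · have h : -x.im t = x.im t := congrFun (congrArg im hx) t
    have h' : 2 * x.im t = 0 := by linear_combination -h
    simpa [ofField, h2] using h'

-- With concrete indices the sums modulo 7 in the product evaluate, and octonion identities become
-- eight polynomial identities for `ring`.
omit [Field F] in
theorem ext_coordinates {x y : Octonion F} (h : x.re = y.re) (h0 : x.im 0 = y.im 0)
    (h1 : x.im 1 = y.im 1) (h2 : x.im 2 = y.im 2) (h3 : x.im 3 = y.im 3) (h4 : x.im 4 = y.im 4)
    (h5 : x.im 5 = y.im 5) (h6 : x.im 6 = y.im 6) : x = y := by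
  ext t
  · exact h
  · fin_cases t <;> assumption

theorem star_mul_cancel_left (u x : Octonion F) : star u * (u * x) = normForm u u • x := by
  apply ext_coordinates <;>
  simp only [normForm, re_mul, im_mul, re_star, im_star, re_smul, im_smul, Fin.sum_univ_seven,
    Fin.isValue, Fin.reduceAdd, Pi.neg_apply, Pi.smul_apply, smul_eq_mul] <;> ring

theorem mul_star_cancel_right (u x : Octonion F) : x * u * star u = normForm u u • x := by
  apply ext_coordinates <;>
  simp only [normForm, re_mul, im_mul, re_star, im_star, re_smul, im_smul, Fin.sum_univ_seven,
    Fin.isValue, Fin.reduceAdd, Pi.neg_apply, Pi.smul_apply, smul_eq_mul] <;> ring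

/-- A Moufang identity. -/
theorem mul_mul_mul_mul (u x y : Octonion F) : u * x * (y * u) = u * (x * y * u) := by
  apply ext_coordinates <;>
  simp only [re_mul, im_mul, Fin.sum_univ_seven, Fin.isValue, Fin.reduceAdd] <;> ring

theorem mul_mul_comm_assoc (u x : Octonion F) : u * x * u = u * (x * u) := by
  apply ext_coordinates <;>
  simp only [re_mul, im_mul, Fin.sum_univ_seven, Fin.isValue, Fin.reduceAdd] <;> ring

set_option maxHeartbeats 800000 in
/-- The right Moufang identity. -/
theorem mul_mul_mul_self (u x y : Octonion F) : x * (u * (y * u)) = x * u * y * u := by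
  apply ext_coordinates <;>
  simp only [re_mul, im_mul, Fin.sum_univ_seven, Fin.isValue, Fin.reduceAdd] <;> ring

/-- The left Moufang identity. -/
theorem mul_mul_self_mul (u x y : Octonion F) : u * (x * u) * y = u * (x * (u * y)) := by
  -- Conjugation reverses products, which reduces the claim to the right Moufang identity for the
  -- conjugates.
  apply star_injective
  simp only [star_mul]
  rw [← mul_mul_mul_self, mul_mul_comm_assoc]

theorem normForm_mul_left (u x y : Octonion F) :
    normForm (u * x) (u * y) = normForm u u * normForm x y := by
  simp only [normForm, re_mul, im_mul, Fin.sum_univ_seven, Fin.isValue, Fin.reduceAdd]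
  ring

theorem normForm_mul_right (u x y : Octonion F) :
    normForm (x * u) (y * u) = normForm u u * normForm x y := by
  simp only [normForm, re_mul, im_mul, Fin.sum_univ_seven, Fin.isValue, Fin.reduceAdd]
  ring

theorem normForm_star (u : Octonion F) :
    normForm (star u) (star u) = normForm u u := by
  simp [normForm]

theorem star_i (t : Fin 7) : star (i t : Octonion F) = -i t := by
  ext <;> simp [i]

theorem i_mul_i (t : Fin 7) : (i t : Octonion F) * i t = -1 := by
  fin_cases t <;> apply ext_coordinates <;> simp [i, Pi.single_apply]

end Octonion

/-! ### The product in coordinates, and idempotents with entries in the field. -/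

namespace AlbertAlgebra

variable {F : Type*} [Field F]

open Octonion Axial

theorem toMatrix_mk (d e f : F) (x y z : Octonion F) :
    toMatrix (mk d e f x y z) = !![ofField d, z, star y; star z, ofField e, x;
      y, star x, ofField f] := rfl

theorem eq_mk (h2 : (2 : F) ≠ 0) (X : AlbertAlgebra F) :
    X = mk (toMatrix X 0 0).re (toMatrix X 1 1).re (toMatrix X 2 2).re
      (toMatrix X 1 2) (toMatrix X 2 0) (toMatrix X 0 1) := by
  have h := fun j k => (isHermitian_toMatrix X).apply j k
  apply toMatrix_injective
  rw [toMatrix_mk, ← eq_ofField_of_star_eq h2 (h 0 0), ← eq_ofField_of_star_eq h2 (h 1 1),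
    ← eq_ofField_of_star_eq h2 (h 2 2), h 0 2, h 1 0, h 2 1]
  exact Matrix.eta_fin_three _

theorem exists_eq_mk (h2 : (2 : F) ≠ 0) (X : AlbertAlgebra F) :
    ∃ d e f x y z, X = mk d e f x y z :=
  ⟨_, _, _, _, _, _, eq_mk h2 X⟩

theorem mk_add (d e f d' e' f' : F) (x y z x' y' z' : Octonion F) :
    mk d e f x y z + mk d' e' f' x' y' z' =
      mk (d + d') (e + e') (f + f') (x + x') (y + y') (z + z') := by
  apply toMatrix_injective
  rw [map_add]
  ext1 j k
  fin_cases j <;> fin_cases k <;> simp [toMatrix_mk, ofField_add]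

theorem smul_mk (c d e f : F) (x y z : Octonion F) :
    c • mk d e f x y z = mk (c * d) (c * e) (c * f) (c • x) (c • y) (c • z) := by
  apply toMatrix_injective
  rw [map_smul]
  ext1 j k
  fin_cases j <;> fin_cases k <;> simp [toMatrix_mk, smul_ofField, star_smul']

/-- Isolating `1/2` leaves an expression with integral coefficients, the one that `intMul`
evaluates. The diagonal entries come from the polarized norm identities. -/
theorem mk_mul (d e f d' e' f' : F) (x y z x' y' z' : Octonion F) :
    mk d e f x y z * mk d' e' f' x' y' z' = (2 : F)⁻¹ •
      mk (2 * (d * d' + normForm y y' + normForm z z'))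
        (2 * (e * e' + normForm x x' + normForm z z'))
        (2 * (f * f' + normForm x x' + normForm y y'))
        ((e + f) • x' + (e' + f') • x + star (y * z') + star (y' * z))
        ((f + d) • y' + (f' + d') • y + star (z * x') + star (z' * x))
        ((d + e) • z' + (d' + e') • z + star (x * y') + star (x' * y)) := by
  apply toMatrix_injective
  rw [map_smul, toMatrix_mul]
  congr 1
  have key : ∀ y y' z z' : Octonion F, ∀ d d' : F,
      d' • ofField d + z * star z' + star y * y' + (d • ofField d' + z' * star z + star y' * y) =
        ofField (2 * (d * d' + normForm y y' + normForm z z')) := by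
    intro y y' z z' d d'
    have h1 := mul_star_add_mul_star z z'
    have h2 := star_mul_add_star_mul y y'
    simp only [ofField_eq_smul_one] at *
    linear_combination (norm := module) h1 + h2
  simp only [toMatrix_mk, Matrix.mul_fin_three, ofField_mul, mul_ofField, star_add, star_smul',
    star_mul, star_star]
  ext1 j k
  fin_cases j <;> fin_cases k
  · exact key y y' z z' d d'
  · simp; module
  · simp; module
  · simp; module
  · convert key z z' x x' e e' using 1
    · simp; abel
    · simp; ring_nf
  · simp; module
  · simp; module
  · simp; module
  · convert key x x' y y' f f' using 1
    · simp; abel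
    · rfl

theorem add_self_toMatrix_mul (h2 : (2 : F) ≠ 0) (X Y : AlbertAlgebra F) :
    toMatrix (X * Y) + toMatrix (X * Y) = toMatrix X * toMatrix Y + toMatrix Y * toMatrix X := by
  rw [toMatrix_mul, ← two_smul F, smul_inv_smul₀ h2]

theorem toMatrix_mul_of_commute (h2 : (2 : F) ≠ 0) {X Y : AlbertAlgebra F}
    (h : toMatrix X * toMatrix Y = toMatrix Y * toMatrix X) :
    toMatrix (X * Y) = toMatrix X * toMatrix Y := by
  rw [toMatrix_mul, ← h, ← two_smul F, inv_smul_smul₀ h2]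

section Nucleus

variable (r : Matrix (Fin 3) (Fin 3) F) (X Y : Matrix (Fin 3) (Fin 3) (Octonion F))

/-- Multiples of `1` commute and associate with all octonions, so a matrix over the field associates
with octonion matrices in each of the three positions. -/
theorem map_ofField_mul_mul : r.map ofField * X * Y = r.map ofField * (X * Y) := by
  ext1 j k
  simp only [Matrix.mul_apply, Matrix.map_apply, ofField_mul, Finset.sum_mul, Finset.smul_sum,
    smul_mul_assoc]
  exact Finset.sum_comm

theorem mul_map_ofField_mul : X * r.map ofField * Y = X * (r.map ofField * Y) := by
  ext1 j k
  simp only [Matrix.mul_apply, Matrix.map_apply, ofField_mul, mul_ofField, Finset.sum_mul,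
    Finset.mul_sum, smul_mul_assoc, mul_smul_comm]
  exact Finset.sum_comm

theorem mul_mul_map_ofField : X * Y * r.map ofField = X * (Y * r.map ofField) := by
  ext1 j k
  simp only [Matrix.mul_apply, Matrix.map_apply, mul_ofField, Finset.smul_sum,
    Finset.mul_sum, mul_smul_comm]
  exact Finset.sum_comm

end Nucleus

/-- The product is `s⁻² v (vᵀ X v) vᵀ`. In `vᵀ X v` each off-diagonal entry is added to its
conjugate, which leaves twice the real part, so `vᵀ X v` is a scalar and `c = s⁻¹ vᵀ X v`. -/
theorem exists_map_ofField_mul_mul_eq_smul (h2 : (2 : F) ≠ 0) (v : Fin 3 → F) (s : F)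
    (X : AlbertAlgebra F) :
    ∃ c : F, (s⁻¹ • Matrix.vecMulVec v v).map ofField *
      (toMatrix X * (s⁻¹ • Matrix.vecMulVec v v).map ofField) =
        c • (s⁻¹ • Matrix.vecMulVec v v).map ofField := by
  obtain ⟨d, e, f, x, y, z, rfl⟩ := exists_eq_mk h2 X
  refine ⟨s⁻¹ * (v 0 * v 0 * d + v 1 * v 1 * e + v 2 * v 2 * f +
    2 * (v 1 * v 2 * x.re + v 2 * v 0 * y.re + v 0 * v 1 * z.re)), ?_⟩
  ext j k
  · simp only [Matrix.mul_apply, Fin.sum_univ_three]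
    simp [toMatrix_mk, Matrix.vecMulVec_apply, ofField]
    ring
  · simp only [Matrix.mul_apply, Fin.sum_univ_three]
    simp [toMatrix_mk, Matrix.vecMulVec_apply, ofField]
    ring

/-- If `s = vᵀ v ≠ 0` for a vector `v` over the field, then `s⁻¹ v vᵀ` is a rank one idempotent. -/
theorem isRankOneIdempotent_of_toMatrix_eq (h2 : (2 : F) ≠ 0) {v : Fin 3 → F} {s : F} (hs : s ≠ 0)
    (hv : v 0 * v 0 + v 1 * v 1 + v 2 * v 2 = s) {e : AlbertAlgebra F} (he0 : e ≠ 0)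
    (he : toMatrix e = (s⁻¹ • Matrix.vecMulVec v v).map ofField) :
    IsRankOneIdempotent F e := by
  set r := s⁻¹ • Matrix.vecMulVec v v with hr
  set E := r.map ofField with hE
  have hEE : E * E = E := by
    ext1 j k
    simp only [E, r, Matrix.mul_apply, Matrix.map_apply, ofField_mul, smul_ofField,
      Matrix.smul_apply, Matrix.vecMulVec_apply, smul_eq_mul, Fin.sum_univ_three, ← ofField_add]
    congr 1
    field_simp
    linear_combination (v j * v k) * hv
  have hEX : ∀ X, E * (E * X) = E * X := fun X => by rw [← map_ofField_mul_mul, hEE]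
  have hXE : ∀ X, X * E * E = X * E := fun X => by rw [mul_mul_map_ofField, hEE]
  -- Multiplying `E x + x E = 0` by `E` on either side gives `E x = -E x E = x E`; then `2 E x = 0`.
  have zero : ∀ x, e * x = 0 → E * toMatrix x = 0 ∧ toMatrix x * E = 0 := by
    intro x hx
    have h := add_self_toMatrix_mul h2 e x
    rw [hx, he, map_zero, add_zero] at h
    have h1 : E * toMatrix x + E * (toMatrix x * E) = 0 := by
      rw [← hEX (toMatrix x), ← mul_add, ← h, mul_zero]
    have h3 : E * (toMatrix x * E) + toMatrix x * E = 0 :=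
      calc E * (toMatrix x * E) + toMatrix x * E = (E * toMatrix x + toMatrix x * E) * E := by
            rw [add_mul, hXE, hE, map_ofField_mul_mul]
        _ = 0 := by rw [← h, zero_mul]
    have h4 : E * toMatrix x = toMatrix x * E :=
      (eq_neg_of_add_eq_zero_left h1).trans (eq_neg_of_add_eq_zero_right h3).symm
    rw [← h4, ← two_smul F] at h
    have h5 := (smul_eq_zero_iff_right h2).1 h.symm
    exact ⟨h5, h4 ▸ h5⟩
  have half : ∀ x, e * x + e * x = x → E * toMatrix x + toMatrix x * E = toMatrix x := by
    intro x hx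
    rw [← he, ← add_self_toMatrix_mul h2, ← map_add, hx]
  refine ⟨he0, ?_, ?_, ?_, ?_, ?_⟩
  · apply toMatrix_injective
    rw [toMatrix_mul_of_commute h2 rfl, he, hEE]
  · intro x
    obtain ⟨c, hc⟩ := exists_map_ofField_mul_mul_eq_smul h2 v s x
    refine ⟨c, ?_⟩
    apply toMatrix_injective
    -- In matrices, `2 e (e x) - e x` is `E x E`.
    rw [map_smul, he, ← hc, map_sub, map_add, add_self_toMatrix_mul h2, toMatrix_mul, he]
    simp only [Matrix.mul_smul, Matrix.smul_mul, ← smul_add, ← smul_sub, mul_add, add_mul, hEX, hXE]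
    rw [hE, map_ofField_mul_mul, ← hE]
    rw [inv_smul_eq_iff₀ h2, two_smul]
    abel
  · intro x y hx hy
    obtain ⟨hx1, hx2⟩ := zero x hx
    obtain ⟨hy1, hy2⟩ := zero y hy
    apply toMatrix_injective
    simp only [toMatrix_mul, he, mul_add, add_mul, Matrix.mul_smul, Matrix.smul_mul, E,
      ← map_ofField_mul_mul, mul_mul_map_ofField]
    simp only [← hE, hx1, hx2, hy1, hy2, zero_mul, mul_zero, add_zero, smul_zero, map_zero]
  · intro x y hx hy
    obtain ⟨hx1, hx2⟩ := zero x hx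
    have h := half y hy
    apply toMatrix_injective
    rw [map_add, add_self_toMatrix_mul h2, he, toMatrix_mul, Matrix.mul_smul, Matrix.smul_mul,
      ← smul_add]
    congr 1
    -- Substituting `y = E y + y E` and using `E x = 0 = x E` shows that `E` fixes `y x` from the
    -- left and, in `h3`, `x y` from the right.
    have h1 : toMatrix y * toMatrix x = E * toMatrix y * toMatrix x := by
      conv_lhs => rw [← h]
      rw [add_mul, mul_map_ofField_mul, hx1, mul_zero, add_zero]
    have h3 : toMatrix x * toMatrix y = toMatrix x * (toMatrix y * E) := by
      conv_lhs => rw [← h]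
      rw [mul_add, ← mul_map_ofField_mul, hx2, zero_mul, zero_add]
    rw [mul_add, add_mul, ← map_ofField_mul_mul, ← map_ofField_mul_mul, mul_mul_map_ofField,
      mul_mul_map_ofField, hx1, hx2, zero_mul, mul_zero, zero_add, add_zero, ← h1, ← h3, add_comm]
  · intro x y hx hy
    -- Since `E x = x - x E` and `y E = y - E y`, both sides equal `x y - x E y`. Thus `E` commutes
    -- with the Jordan product, on which `e` then acts as left multiplication by the idempotent `E`.
    have key : ∀ x y, e * x + e * x = x → e * y + e * y = y →
        E * (toMatrix x * toMatrix y) = toMatrix x * toMatrix y * E := by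
      intro x y hx hy
      rw [← map_ofField_mul_mul, mul_mul_map_ofField, eq_sub_of_add_eq (half x hx),
        eq_sub_of_add_eq' (half y hy), sub_mul, mul_sub, mul_map_ofField_mul]
    have hcomm : toMatrix e * toMatrix (x * y) = toMatrix (x * y) * toMatrix e := by
      rw [he, toMatrix_mul, Matrix.mul_smul, Matrix.smul_mul, mul_add, add_mul, key x y hx hy,
        key y x hy hx]
    have h := toMatrix_mul_of_commute h2 hcomm
    apply toMatrix_injective
    rw [toMatrix_mul_of_commute h2, h, he, hEX]
    rw [h, he, hEX, map_ofField_mul_mul, ← he, ← hcomm, he, hEX]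

end AlbertAlgebra

/-! ### Automorphisms that move the four axes to matrices over the field. -/

namespace AlbertAlgebra

variable {F : Type*} [Field F]

open Octonion Axial

/-- The cyclic shift `(d, e, f | x, y, z) ↦ (e, f, d | y, z, x)`. -/
def rotate : AlbertAlgebra F →ₗ[F] AlbertAlgebra F where
  toFun X := mk (toMatrix X 1 1).re (toMatrix X 2 2).re (toMatrix X 0 0).re
    (toMatrix X 2 0) (toMatrix X 0 1) (toMatrix X 1 2)
  map_add' X Y := by simp [mk_add]
  map_smul' c X := by simp [smul_mk]

theorem rotate_mk (d e f : F) (x y z : Octonion F) :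
    rotate (mk d e f x y z) = mk e f d y z x := rfl

theorem rotate_injective (h2 : (2 : F) ≠ 0) : Function.Injective (rotate (F := F)) := by
  have h : ∀ X : AlbertAlgebra F, rotate (rotate (rotate X)) = X := by
    intro X
    obtain ⟨d, e, f, x, y, z, rfl⟩ := exists_eq_mk h2 X
    rfl
  intro X Y hXY
  rw [← h X, hXY, h]

theorem rotate_mul (h2 : (2 : F) ≠ 0) (X Y : AlbertAlgebra F) :
    rotate (X * Y) = rotate X * rotate Y := by
  obtain ⟨d, e, f, x, y, z, rfl⟩ := exists_eq_mk h2 X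
  obtain ⟨d', e', f', x', y', z', rfl⟩ := exists_eq_mk h2 Y
  rw [mk_mul, map_smul, rotate_mk, rotate_mk, rotate_mk, mk_mul]
  congr 2 <;> ring

/-- The map `(d, e, f | x, y, z) ↦ (d, e, f | u x, y u, ū z ū)`, where `ū` is the conjugate
of `u`. -/
def twist (u : Octonion F) : AlbertAlgebra F →ₗ[F] AlbertAlgebra F where
  toFun X := mk (toMatrix X 0 0).re (toMatrix X 1 1).re (toMatrix X 2 2).re
    (u * toMatrix X 1 2) (toMatrix X 2 0 * u) (star u * (toMatrix X 0 1 * star u))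
  map_add' X Y := by simp [mk_add, mul_add, add_mul]
  map_smul' c X := by simp [smul_mk, mul_smul_comm, smul_mul_assoc]

theorem twist_mk (u : Octonion F) (d e f : F) (x y z : Octonion F) :
    twist u (mk d e f x y z) = mk d e f (u * x) (y * u) (star u * (z * star u)) := rfl

variable {u : Octonion F} (hu : normForm u u = 1)
include hu

theorem star_mul_mul_cancel (x : Octonion F) : star u * (u * x) = x := by
  rw [star_mul_cancel_left, hu, one_smul]

theorem mul_mul_star_cancel (x : Octonion F) : x * u * star u = x := by
  rw [mul_star_cancel_right, hu, one_smul]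

/-- Each off-diagonal component uses one Moufang identity: `h1` the middle, `h3` the right and `h4`
the left one. The diagonal is preserved because multiplication by `u` is an isometry. -/
theorem twist_mul (h2 : (2 : F) ≠ 0) (X Y : AlbertAlgebra F) :
    twist u (X * Y) = twist u X * twist u Y := by
  obtain ⟨d, e, f, x, y, z, rfl⟩ := exists_eq_mk h2 X
  obtain ⟨d', e', f', x', y', z', rfl⟩ := exists_eq_mk h2 Y
  have h1 : ∀ x y, star (u * x * (y * u)) = star u * (star (x * y) * star u) := by
    intro x y
    rw [mul_mul_mul_mul, star_mul, star_mul, mul_mul_comm_assoc]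
  have h3 : ∀ y z, star (y * u * (star u * (z * star u))) = u * star (y * z) := by
    intro y z
    rw [mul_mul_mul_self, mul_mul_star_cancel hu, star_mul, star_star]
  have h4 : ∀ z x, star (star u * (z * star u) * (u * x)) = star (z * x) * u := by
    intro z x
    rw [mul_mul_self_mul, star_mul_mul_cancel hu, star_mul, star_star]
  have hu' : normForm (star u) (star u) = 1 := by rw [normForm_star, hu]
  rw [mk_mul, map_smul, twist_mk, twist_mk, twist_mk, mk_mul]
  congr 2
  all_goals simp only [h1, h3, h4, normForm_mul_left, normForm_mul_right, hu, hu', one_mul,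
    mul_add, add_mul, mul_smul_comm, smul_mul_assoc]

theorem twist_injective (h2 : (2 : F) ≠ 0) : Function.Injective (twist u) := by
  have hu' : normForm (star u) (star u) = 1 := by rw [normForm_star, hu]
  have h : ∀ X : AlbertAlgebra F, twist (star u) (twist u X) = X := by
    intro X
    obtain ⟨d, e, f, x, y, z, rfl⟩ := exists_eq_mk h2 X
    rw [twist_mk, twist_mk, star_mul_mul_cancel hu, mul_mul_star_cancel hu, star_star]
    have h1 := mul_mul_star_cancel hu' (star u * z)
    have h3 := star_mul_mul_cancel hu' z
    rw [star_star] at h1 h3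
    rw [← mul_mul_comm_assoc (star u), h1, h3]
  intro X Y hXY
  rw [← h X, hXY, h]

omit hu

theorem normForm_i (t : Fin 7) : normForm (i t : Octonion F) (i t) = 1 := by
  simp [normForm, i, Pi.single_apply]

theorem isRankOneIdempotent_of_rotate (h2 : (2 : F) ≠ 0) {X : AlbertAlgebra F}
    (h : IsRankOneIdempotent F (rotate X)) : IsRankOneIdempotent F X :=
  .of_map rotate (rotate_injective h2) (rotate_mul h2) h

theorem isRankOneIdempotent_of_twist (h2 : (2 : F) ≠ 0) (t : Fin 7) {X : AlbertAlgebra F}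
    (h : IsRankOneIdempotent F (twist (i t) X)) : IsRankOneIdempotent F X :=
  .of_map (twist (i t)) (twist_injective (normForm_i t) h2) (twist_mul (normForm_i t) h2) h

/-- The idempotent `s⁻¹ v vᵀ` for `v = (p, q, r)` with entries in the field. -/
theorem isRankOneIdempotent_smul_mk (h2 : (2 : F) ≠ 0) (p q r : F) {s : F} (hs : s ≠ 0)
    (hv : p * p + q * q + r * r = s) :
    IsRankOneIdempotent F (s⁻¹ • mk (p * p) (q * q) (r * r) (ofField (q * r)) (ofField (r * p))
      (ofField (p * q))) := by
  refine isRankOneIdempotent_of_toMatrix_eq h2 (v := ![p, q, r]) hs hv ?_ ?_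
  · intro h
    have h' : ∀ k, (toMatrix (mk (p * p) (q * q) (r * r) (ofField (q * r)) (ofField (r * p))
      (ofField (p * q))) k k).re = 0 := by
      intro k
      rw [(smul_eq_zero_iff_right (inv_ne_zero hs)).1 h]
      rfl
    have h0 : p * p = 0 := h' 0
    have h1 : q * q = 0 := h' 1
    have h2 : r * r = 0 := h' 2
    exact hs (by rw [← hv, h0, h1, h2]; simp)
  · rw [map_smul, toMatrix_mk]
    ext1 j k
    fin_cases j <;> fin_cases k <;>
      simp [smul_ofField, star_ofField, mul_comm]

theorem twist_i_mk_i (t : Fin 7) (c d e f : F) :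
    twist (i t) (c • mk d e f (i t) 0 0) = c • mk d e f (ofField (-1)) 0 0 := by
  rw [map_smul, twist_mk]
  congr 2
  · rw [i_mul_i, ofField_eq_smul_one, neg_one_smul]
  · exact zero_mul _
  · rw [zero_mul, mul_zero]

theorem isRankOneIdempotent_half_smul_mk (h2 : (2 : F) ≠ 0) (t : Fin 7) :
    IsRankOneIdempotent F ((1 / 2 : F) • mk (0 : F) 1 1 (i t) 0 0) := by
  -- The twist turns the entry `i_t` into `i_t² = -1`, which gives `v = (0, 1, -1)` and `s = 2`.
  apply isRankOneIdempotent_of_twist h2 t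
  rw [twist_i_mk_i]
  convert isRankOneIdempotent_smul_mk h2 0 1 (-1) h2 (by norm_num) using 2
  · simp
  · simp [ofField]; rfl

theorem isRankOneIdempotent_axisA (h2 : (2 : F) ≠ 0) : IsRankOneIdempotent F (axisA F) := by
  apply isRankOneIdempotent_of_rotate h2
  apply isRankOneIdempotent_of_rotate h2
  rw [axisA, map_smul, map_smul]
  exact isRankOneIdempotent_half_smul_mk h2 0

theorem isRankOneIdempotent_axisB (h2 : (2 : F) ≠ 0) : IsRankOneIdempotent F (axisB F) := by
  apply isRankOneIdempotent_of_rotate h2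
  rw [axisB, map_smul]
  exact isRankOneIdempotent_half_smul_mk h2 1

theorem isRankOneIdempotent_axisC (h2 : (2 : F) ≠ 0) : IsRankOneIdempotent F (axisC F) :=
  isRankOneIdempotent_half_smul_mk h2 2

theorem isRankOneIdempotent_axisD (h2 : (2 : F) ≠ 0) (h3 : (3 : F) ≠ 0) :
    IsRankOneIdempotent F (axisD F) := by
  -- Up to the factor `1/9`, the images are `(1, 4, 4 | -4, 2i₆, 2i₆)`, then `(4, 4, 1 | 2i₆, 2i₆,
  -- -4)`, then `(4, 4, 1 | -2, -2, 4)`. The last is `v vᵀ` for `v = (2, 2, -1)`, with `s = 9`.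
  apply isRankOneIdempotent_of_twist h2 4
  apply isRankOneIdempotent_of_rotate h2
  apply isRankOneIdempotent_of_twist h2 6
  have h9 : (9 : F) ≠ 0 := by
    rw [show (9 : F) = 3 * 3 by norm_num]
    exact mul_ne_zero h3 h3
  rw [axisD, map_smul, map_smul, map_smul, twist_mk, rotate_mk, twist_mk]
  convert isRankOneIdempotent_smul_mk h2 2 2 (-1) h9 (by norm_num) using 2
  · simp
  · have h34 : (i 3 : Octonion F) * i 4 = i 6 := by
      apply ext_coordinates <;> simp [i, Pi.single_apply]
    have h64 : (i 6 : Octonion F) * i 4 = -i 3 := by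
      apply ext_coordinates <;> simp [i, Pi.single_apply]
    have h43 : (i 4 : Octonion F) * i 3 = -i 6 := by
      apply ext_coordinates <;> simp [i, Pi.single_apply]
    simp only [smul_mul_assoc, mul_smul_comm, star_i, neg_mul, mul_neg, neg_neg, h34, h64, h43,
      i_mul_i, one_mul, ofField_eq_smul_one]
    congr 1
    all_goals norm_num

end AlbertAlgebra

/-! ### Coordinates and a model of the product over the integers. -/

namespace AlbertAlgebra

open Octonion

/-- The coordinates of `(d, e, f | x, y, z)`. -/
def coordinates {R : Type*} (d e f : R) (x y z : Octonion R) : Fin 27 → R :=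
  ![d, e, f, x.re, x.im 0, x.im 1, x.im 2, x.im 3, x.im 4, x.im 5, x.im 6,
    y.re, y.im 0, y.im 1, y.im 2, y.im 3, y.im 4, y.im 5, y.im 6,
    z.re, z.im 0, z.im 1, z.im 2, z.im 3, z.im 4, z.im 5, z.im 6]

/-- The first octonion in a coordinate vector. -/
def octonion₁ {R : Type*} (v : Fin 27 → R) : Octonion R :=
  ⟨v 3, ![v 4, v 5, v 6, v 7, v 8, v 9, v 10]⟩

/-- The second octonion in a coordinate vector. -/
def octonion₂ {R : Type*} (v : Fin 27 → R) : Octonion R :=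
  ⟨v 11, ![v 12, v 13, v 14, v 15, v 16, v 17, v 18]⟩

/-- The third octonion in a coordinate vector. -/
def octonion₃ {R : Type*} (v : Fin 27 → R) : Octonion R :=
  ⟨v 19, ![v 20, v 21, v 22, v 23, v 24, v 25, v 26]⟩

section Coordinates

variable {F : Type*} [Field F]

variable (F) in
/-- The element of the Albert algebra with given coordinates. -/
def ofCoordinates : (Fin 27 → F) →ₗ[F] AlbertAlgebra F where
  toFun v := mk (v 0) (v 1) (v 2) (octonion₁ v) (octonion₂ v) (octonion₃ v)
  map_add' v w := by
    rw [mk_add]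
    congr 1 <;> apply ext_coordinates <;> rfl
  map_smul' c v := by
    rw [RingHom.id_apply, smul_mk]
    congr 1 <;> apply ext_coordinates <;> rfl

theorem ofCoordinates_apply (v : Fin 27 → F) :
    ofCoordinates F v = mk (v 0) (v 1) (v 2) (octonion₁ v) (octonion₂ v) (octonion₃ v) := rfl

theorem ofCoordinates_coordinates (d e f : F) (x y z : Octonion F) :
    ofCoordinates F (coordinates d e f x y z) = mk d e f x y z := by
  rw [ofCoordinates_apply]
  congr 1 <;> apply ext_coordinates <;> rfl

theorem ofCoordinates_bijective (h2 : (2 : F) ≠ 0) : Function.Bijective (ofCoordinates F) := by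
  refine ⟨Function.LeftInverse.injective (g := fun X => coordinates (toMatrix X 0 0).re
    (toMatrix X 1 1).re (toMatrix X 2 2).re (toMatrix X 1 2) (toMatrix X 2 0) (toMatrix X 0 1))
    fun v => ?_, fun X => ?_⟩
  · funext k
    fin_cases k <;> rfl
  · obtain ⟨d, e, f, x, y, z, rfl⟩ := exists_eq_mk h2 X
    exact ⟨_, ofCoordinates_coordinates d e f x y z⟩

theorem finrank_eq (h2 : (2 : F) ≠ 0) : Module.finrank F (AlbertAlgebra F) = 27 := by
  rw [← (LinearEquiv.ofBijective _ (ofCoordinates_bijective h2)).finrank_eq,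
    Module.finrank_fin_fun]

end Coordinates

/-- The conjugate of a product of integral octonions. -/
def intStarMul (x y : Octonion ℤ) : Octonion ℤ :=
  ⟨x.re * y.re - (x.im 0 * y.im 0 + x.im 1 * y.im 1 + x.im 2 * y.im 2 + x.im 3 * y.im 3
      + x.im 4 * y.im 4 + x.im 5 * y.im 5 + x.im 6 * y.im 6),
    fun t => -(x.re * y.im t + x.im t * y.re
     + (x.im (t + 4) * y.im (t + 5) - x.im (t + 5) * y.im (t + 4))
     + (x.im (t + 1) * y.im (t + 3) - x.im (t + 3) * y.im (t + 1))
     + (x.im (t + 2) * y.im (t + 6) - x.im (t + 6) * y.im (t + 2)))⟩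

/-- The integral octonion `n i_t`. -/
def intMultiple (n : ℤ) (t : Fin 7) : Octonion ℤ := ⟨0, fun s => if s = t then n else 0⟩

/-- The norm form on integral octonions. -/
def intNormForm (x y : Octonion ℤ) : ℤ :=
  x.re * y.re + (x.im 0 * y.im 0 + x.im 1 * y.im 1 + x.im 2 * y.im 2 + x.im 3 * y.im 3
      + x.im 4 * y.im 4 + x.im 5 * y.im 5 + x.im 6 * y.im 6)

/-- The off-diagonal component `k x' + k' x + star (y z') + star (y' z)` of a doubled product. -/
def intOffDiagonal (k k' : ℤ) (x x' y y' z z' : Octonion ℤ) : Octonion ℤ :=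
  ⟨k * x'.re + k' * x.re + (intStarMul y z').re + (intStarMul y' z).re,
    fun t => k * x'.im t + k' * x.im t + (intStarMul y z').im t + (intStarMul y' z).im t⟩

/-- Twice the product of the Albert algebra, on integral coordinates. -/
def intMul (v w : Fin 27 → ℤ) : Fin 27 → ℤ :=
  coordinates
    (2 * (v 0 * w 0 + intNormForm (octonion₂ v) (octonion₂ w)
      + intNormForm (octonion₃ v) (octonion₃ w)))
    (2 * (v 1 * w 1 + intNormForm (octonion₁ v) (octonion₁ w)
      + intNormForm (octonion₃ v) (octonion₃ w)))
    (2 * (v 2 * w 2 + intNormForm (octonion₁ v) (octonion₁ w)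
      + intNormForm (octonion₂ v) (octonion₂ w)))
    (intOffDiagonal (v 1 + v 2) (w 1 + w 2) (octonion₁ v) (octonion₁ w) (octonion₂ v)
      (octonion₂ w) (octonion₃ v) (octonion₃ w))
    (intOffDiagonal (v 2 + v 0) (w 2 + w 0) (octonion₂ v) (octonion₂ w) (octonion₃ v)
      (octonion₃ w) (octonion₁ v) (octonion₁ w))
    (intOffDiagonal (v 0 + v 1) (w 0 + w 1) (octonion₃ v) (octonion₃ w) (octonion₁ v)
      (octonion₁ w) (octonion₂ v) (octonion₂ w))

section IntegralCoordinates

variable {F : Type*} [Field F]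

variable (F) in
/-- The image of an integral octonion in the octonions over `F`. -/
def _root_.Octonion.ofInt (x : Octonion ℤ) : Octonion F := ⟨x.re, fun t => x.im t⟩

theorem ofInt_intMultiple (n : ℤ) (t : Fin 7) : ofInt F (intMultiple n t) = (n : F) • i t := by
  ext s <;> simp [ofInt, intMultiple, i, Pi.single_apply]

theorem ofInt_intStarMul (x y : Octonion ℤ) :
    ofInt F (intStarMul x y) = star (ofInt F x * ofInt F y) := by
  ext t
  · simp [ofInt, intStarMul, Fin.sum_univ_seven, -star_mul]
  · simp [ofInt, intStarMul, -star_mul]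

theorem intCast_intNormForm (x y : Octonion ℤ) :
    ((intNormForm x y : ℤ) : F) = normForm (ofInt F x) (ofInt F y) := by
  simp [ofInt, intNormForm, normForm, Fin.sum_univ_seven]

theorem ofInt_intOffDiagonal (k k' : ℤ) (x x' y y' z z' : Octonion ℤ) :
    ofInt F (intOffDiagonal k k' x x' y y' z z') = (k : F) • ofInt F x' + (k' : F) • ofInt F x +
      star (ofInt F y * ofInt F z') + star (ofInt F y' * ofInt F z) := by
  rw [← ofInt_intStarMul, ← ofInt_intStarMul]
  ext t <;> simp [ofInt, intOffDiagonal]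

theorem ofCoordinates_intCast (v : Fin 27 → ℤ) :
    ofCoordinates F (fun k => (v k : F)) = mk (v 0 : F) (v 1) (v 2) (ofInt F (octonion₁ v))
      (ofInt F (octonion₂ v)) (ofInt F (octonion₃ v)) := by
  rw [ofCoordinates_apply]
  congr 1 <;> apply ext_coordinates <;> rfl

theorem ofCoordinates_intCast_coordinates (d e f : ℤ) (x y z : Octonion ℤ) :
    ofCoordinates F (fun k => ((coordinates d e f x y z k : ℤ) : F)) =
      mk (d : F) e f (ofInt F x) (ofInt F y) (ofInt F z) := by
  rw [ofCoordinates_apply]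
  congr 1 <;> apply ext_coordinates <;> rfl

theorem ofCoordinates_intMul (h2 : (2 : F) ≠ 0) (v w : Fin 27 → ℤ) :
    ofCoordinates F (fun k => (intMul v w k : F)) = (2 : F) •
      (ofCoordinates F (fun k => (v k : F)) * ofCoordinates F (fun k => (w k : F))) := by
  rw [intMul, ofCoordinates_intCast_coordinates, ofCoordinates_intCast, ofCoordinates_intCast,
    mk_mul, smul_inv_smul₀ h2]
  simp only [ofInt_intOffDiagonal, Int.cast_mul, Int.cast_add, Int.cast_ofNat,
    intCast_intNormForm]

/-- The vector `v` holds the coordinates of a nonzero integral multiple `m • X`. -/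
structure IsIntegralMultiple (m : ℤ) (v : Fin 27 → ℤ) (X : AlbertAlgebra F) : Prop where
  ne_zero : (m : F) ≠ 0
  smul_eq : (m : F) • X = ofCoordinates F (fun k => (v k : F))

/-- The conditions `hn` and `hw` mention only integers, so each product is checked by evaluation
once for all fields. The factor 2 clears the `1/2` of the Jordan product. -/
theorem IsIntegralMultiple.mul (h2 : (2 : F) ≠ 0) {l m n : ℤ} {u v w : Fin 27 → ℤ}
    {X Y : AlbertAlgebra F} (hX : IsIntegralMultiple l u X) (hY : IsIntegralMultiple m v Y)
    (hn : n = 2 * (l * m)) (hw : ∀ k, w k = intMul u v k) : IsIntegralMultiple n w (X * Y) := by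
  subst hn
  obtain rfl := funext hw
  constructor
  · push_cast
    exact mul_ne_zero h2 (mul_ne_zero hX.ne_zero hY.ne_zero)
  · rw [ofCoordinates_intMul h2, ← hX.smul_eq, ← hY.smul_eq, smul_mul_assoc, mul_smul_comm,
      smul_smul, smul_smul]
    push_cast
    rw [mul_assoc]

end IntegralCoordinates

/-- The factors by which the elements of `products` are multiplied to get integral coordinates. -/
def productFactor : Fin 27 → ℤ :=
  ![2, 2, 2, 9, 8, 8, 36, 8, 36, 36, 32, 32, 32, 144, 144, 144, 144, 144, 144,
    576, 576, 576, 576, 576, 2304, 2304, 2304]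

/-- The integral coordinates of the multiples of the elements of `products`. -/
def productCoordinates : Matrix (Fin 27) (Fin 27) ℤ :=
  !![1, 1, 0, 0, 0, 0, 0, 0, 0, 0, 0, 0, 0, 0, 0, 0, 0, 0, 0, 0, 1, 0, 0, 0, 0, 0, 0;
    1, 0, 1, 0, 0, 0, 0, 0, 0, 0, 0, 0, 0, 1, 0, 0, 0, 0, 0, 0, 0, 0, 0, 0, 0, 0, 0;
    0, 1, 1, 0, 0, 0, 1, 0, 0, 0, 0, 0, 0, 0, 0, 0, 0, 0, 0, 0, 0, 0, 0, 0, 0, 0, 0;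
    1, 4, 4, 0, 0, 0, 0, 0, 4, 0, 0, 0, 0, 0, 0, 2, 0, 0, 0, 0, 0, 0, 0, 0, 0, 0, 2;
    2, 0, 0, 0, 0, 0, 0, 1, 0, 0, 0, 0, 0, 1, 0, 0, 0, 0, 0, 0, 1, 0, 0, 0, 0, 0, 0;
    0, 2, 0, 0, 0, 0, 1, 0, 0, 0, 0, 0, 0, 0, 0, 0, 0, 0, -1, 0, 1, 0, 0, 0, 0, 0, 0;
    2, 8, 0, 0, 0, -2, 0, 0, 4, 0, 0, 0, 0, 0, 0, 2, 0, -4, 0, 0, 5, 0, 0, 0, 0, 0, 4;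
    0, 0, 2, 0, 0, 0, 1, 0, 0, 0, 0, 0, 0, 1, 0, 0, 0, 0, 0, 0, 0, 0, 0, 0, 1, 0, 0;
    2, 0, 8, 0, 0, 0, 0, 0, 4, 2, 0, 0, 0, 5, 0, 4, 0, 0, 0, 0, 0, 0, -4, 0, 0, 0, 2;
    0, 8, 8, 0, 0, 0, 8, 0, 8, 0, 0, 0, 2, 0, 0, 2, 0, 0, 0, 0, 0, 0, 0, 0, 0, -2, 2;
    0, 0, 0, 0, 0, 0, 1, 1, 0, 0, 0, 0, 0, 1, 0, 0, 0, 0, -1, 0, 0, 0, 0, 0, 2, 0, 0;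
    0, 0, 0, 0, 0, 0, 1, 1, 0, 0, 0, 0, 0, 0, 0, 0, 0, 0, -2, 0, 1, 0, 0, 0, 1, 0, 0;
    0, 0, 0, 0, 0, 0, 0, 2, 0, 0, 0, 0, 0, 1, 0, 0, 0, 0, -1, 0, 1, 0, 0, 0, 1, 0, 0;
    4, 0, 0, 0, 0, -4, 0, 5, 4, 2, 0, 0, 0, 5, 0, 4, 2, -4, 0, 0, 2, 0, -8, 0, 0, 0, 4;
    0, 16, 0, -2, 0, -2, 8, 0, 8, 0, 0, 0, 2, 0, 0, 2, 0, -8, -8, 0, 8, 0, 0, 0, 0, -4, 4;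
    4, 0, 0, 0, 0, -2, 0, 5, 4, 4, 0, 0, 0, 2, 0, 4, 0, -8, 0, 2, 5, 0, -4, 0, 0, 0, 4;
    0, 0, 16, 0, 0, 0, 8, 0, 8, 2, 2, 0, 4, 8, 0, 4, 0, 0, 0, 0, 0, 0, -8, 0, 8, -2, 2;
    0, 16, 0, 0, 0, -4, 8, 0, 8, 0, 0, 0, 4, 0, 0, 2, 0, -4, -5, 0, 5, 0, 0, -4, 0, -2, 4;
    0, 0, 16, 0, 0, 0, 8, 0, 8, 4, 0, 4, 2, 5, 0, 4, 0, 0, 0, 0, 0, 0, -4, 0, 5, -4, 2;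
    0, 0, 0, -2, 0, -2, 0, 16, 0, 2, 2, 0, 4, 8, -2, 4, -2, -8, -8, -2, 8, -2, -8, 0, 8, -4, 4;
    0, 0, 0, 2, 4, -4, 8, 5, 8, 4, 0, 4, 2, 0, 0, 0, 2, -4, -10, 0, 2, 2, -8, 4, 5, -4, 4;
    0, 0, 0, 2, 0, 0, 8, 8, 0, 2, -4, -8, 2, 5, 0, 0, -2, 0, -5, -2, 0, 0, -4, 4, 10, -2, 0;
    0, 0, 0, 4, 0, -2, 8, 8, 0, 0, -2, -4, 2, 0, 0, 0, -2, -4, -10, -2, 5, 0, 0, 8, 5, -2, 0;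
    0, 0, 0, -4, 0, -4, 8, 8, 8, 2, 2, 0, 4, 8, 2, 4, 2, -8, -8, 0, 0, 0, -16, 0, 16, -4, 4;
    10, 10, 0, -4, 4, -2, 5, 21, 4, 4, 2, 4, 8, 5, -2, 8, -4, -16, -18, 2, 26, -4, -4, -8, 3, -4, 8;
    10, 0, 10, -2, -4, -4, 5, 21, 4, 2, 4, 8, 4, 26, -4, 8, 2, -4, -3, -4, 5, -2, -16, -4, 18, -8,
      8;
    0, 16, 16, -2, 8, -2, 32, 0, 16, 4, 4, 8, 2, 8, 2, 2, 2, -8, -24, 2, 8, 2, -16, 8, 24, -8, 8]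

/-- A multiple of the inverse of `productCoordinates`. -/
def productCoordinatesInverse : Matrix (Fin 27) (Fin 27) ℤ :=
  !![8, 8, 8, 0, 0, -8, 0, -8, 0, 0, 4, 4, -4, 0, 0, 0, 0, 0, 0, 0, 0, 0, 0, 0, 0, 0, 0;
    8, 8, 8, 0, -8, 0, 0, -8, 0, 0, 4, -4, 4, 0, 0, 0, 0, 0, 0, 0, 0, 0, 0, 0, 0, 0, 0;
    8, 8, 8, 0, -8, -8, 0, 0, 0, 0, -4, 4, 4, 0, 0, 0, 0, 0, 0, 0, 0, 0, 0, 0, 0, 0, 0;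
    356, 516, 636, -168, -472, -596, 80, -736, 36, 24, 210, 178, 242, 16, 12, -24, 24, -16, 4,
      -16, -12, 4, -4, -16, 4, 0, 4;
    76, 100, 220, -32, -92, -190, 16, -214, 4, -8, 78, 26, 68, 12, 10, -12, 12, -4, 4, -4, -4, 2,
      -2, -8, 2, -2, 2;
    120, 264, 376, -80, -216, -284, 48, -416, 12, 4, 120, 88, 120, 8, 12, -16, 20, -16, 4, -12,
      -4, 4, -4, -8, 4, 0, 0;
    -16, -16, 0, 0, 16, 8, 0, 8, 0, 0, 0, 0, -8, 0, 0, 0, 0, 0, 0, 0, 0, 0, 0, 0, 0, 0, 0;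
    0, 0, 16, 0, 0, -8, 0, -8, 0, 0, 0, 0, 8, 0, 0, 0, 0, 0, 0, 0, 0, 0, 0, 0, 0, 0, 0;
    194, 194, 106, -84, -200, -174, 32, -174, 32, 40, 73, 73, 63, -4, -6, -4, -6, -6, -6, 0, 0,
      -2, -2, 0, 0, 0, 0;
    -88, 56, 160, 16, 32, -36, 8, -168, -28, -32, 48, 16, 16, 16, 12, -8, 20, -4, 16, 0, -4, 4,
      -4, -8, 0, -4, 0;
    12, 172, 396, -24, -80, -268, 24, -408, -20, -36, 102, 70, 102, 24, 20, -16, 32, -4, 16, -4,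
      -12, 4, -4, -16, 0, -4, 4;
    30, -30, -142, -12, -6, 88, 0, 132, 18, 26, -23, -17, -33, -14, -12, 6, -16, 0, -8, 2, 6, -4,
      2, 8, 0, 2, -2;
    -344, -360, -368, 144, 368, 436, -56, 444, -48, -44, -140, -148, -160, -4, 0, 12, 0, 8, 4, 4,
      8, 0, 4, 8, 0, 0, -4;
    -16, 0, -16, 0, 8, 16, 0, 8, 0, 0, 0, -8, 0, 0, 0, 0, 0, 0, 0, 0, 0, 0, 0, 0, 0, 0, 0;
    32, 320, 608, -64, -184, -404, 56, -636, -16, -40, 136, 104, 188, 28, 24, -28, 40, -12, 24,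
      -16, -16, 8, -4, -16, 4, -4, 4;
    -172, -252, -124, 88, 216, 164, -40, 204, -24, -40, -58, -90, -70, 4, 8, 4, 4, 8, 4, 0, 0, 0,
      4, 0, 0, 0, 0;
    -148, 76, 340, 40, 32, -116, 8, -316, -56, -68, 82, 10, 62, 36, 32, -20, 44, -12, 24, -12, -8,
      8, -4, -16, 4, -4, 0;
    -184, -236, -268, 88, 226, 260, -40, 300, -26, -22, -106, -80, -96, -2, -4, 10, -6, 10, 2, 6,
      2, 0, 2, 4, -2, 0, 0;
    0, -16, 0, 0, 8, 0, 0, 8, 0, 0, 0, -8, 0, 0, 0, 0, 0, 0, 0, 0, 0, 0, 0, 0, 0, 0, 0;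
    -276, -500, -732, 168, 400, 588, -96, 788, -32, -12, -262, -190, -210, -20, -20, 36, -32, 24,
      -12, 12, 8, -4, 8, 16, -4, 4, 0;
    0, -16, -16, 0, 8, 8, 0, 16, 0, 0, -8, 0, 0, 0, 0, 0, 0, 0, 0, 0, 0, 0, 0, 0, 0, 0, 0;
    -384, -672, -576, 192, 552, 564, -96, 796, -24, -48, -248, -216, -228, -28, -4, 28, -20, 24,
      -12, 8, 16, -4, 8, 16, -4, 4, -4;
    -148, -96, 0, 56, 134, 74, -16, 34, -30, -36, -12, -38, -28, 10, 10, -2, 12, 2, 10, 0, -2, 2,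
      0, -4, 0, -2, 0;
    -234, -294, -374, 108, 282, 370, -48, 414, -30, -20, -123, -117, -139, -6, -6, 14, -10, 8, 0,
      8, 6, -2, 4, 8, -2, 0, -2;
    16, 0, 0, 0, -8, -8, 0, 0, 0, 0, 8, 0, 0, 0, 0, 0, 0, 0, 0, 0, 0, 0, 0, 0, 0, 0, 0;
    8, -8, -128, -16, 0, 108, 8, 116, 16, 28, 4, -4, -48, -12, -12, 4, -12, -4, -8, 4, 8, -4, 0,
      8, 0, 0, -4;
    -252, -172, -124, 88, 216, 204, -24, 164, -40, -40, -90, -58, -70, 4, 4, 4, 8, 4, 8, 0, 0, 4,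
      0, 0, 0, 0, 0]

theorem productCoordinatesInverse_mul :
    productCoordinatesInverse * productCoordinates = (16 : ℤ) • 1 := by
  have h : ∀ i j, ∑ k, productCoordinatesInverse i k * productCoordinates k j =
      if i = j then 16 else 0 := by
    decide +kernel
  ext i j
  simp [Matrix.mul_apply, Matrix.one_apply, h]

/-! ### The 27 products form a basis. -/

section Products

variable {F : Type*} [Field F]

theorem isIntegralMultiple_products (h2 : (2 : F) ≠ 0) (h3 : (3 : F) ≠ 0) (j : Fin 27) :
    IsIntegralMultiple (productFactor j) (productCoordinates j)
      (products (axisA F) (axisB F) (axisC F) (axisD F) j) := by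
  have h0' : IsIntegralMultiple (productFactor 0) (productCoordinates 0) (axisA F) := by
    have hc : ((productFactor 0 : ℤ) : F) = 2 := by simp [productFactor]
    refine ⟨hc ▸ h2, ?_⟩
    have hw : productCoordinates 0 =
        coordinates 1 1 0 (intMultiple 0 0) (intMultiple 0 0) (intMultiple 1 0) :=
      funext (by decide +kernel)
    rw [hc, axisA, one_div, smul_inv_smul₀ h2, hw, ofCoordinates_intCast_coordinates]
    simp [ofInt_intMultiple]
  have h1' : IsIntegralMultiple (productFactor 1) (productCoordinates 1) (axisB F) := by
    have hc : ((productFactor 1 : ℤ) : F) = 2 := by simp [productFactor]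
    refine ⟨hc ▸ h2, ?_⟩
    have hw : productCoordinates 1 =
        coordinates 1 0 1 (intMultiple 0 0) (intMultiple 1 1) (intMultiple 0 0) :=
      funext (by decide +kernel)
    rw [hc, axisB, one_div, smul_inv_smul₀ h2, hw, ofCoordinates_intCast_coordinates]
    simp [ofInt_intMultiple]
  have h2' : IsIntegralMultiple (productFactor 2) (productCoordinates 2) (axisC F) := by
    have hc : ((productFactor 2 : ℤ) : F) = 2 := by simp [productFactor]
    refine ⟨hc ▸ h2, ?_⟩
    have hw : productCoordinates 2 =
        coordinates 0 1 1 (intMultiple 1 2) (intMultiple 0 0) (intMultiple 0 0) :=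
      funext (by decide +kernel)
    rw [hc, axisC, one_div, smul_inv_smul₀ h2, hw, ofCoordinates_intCast_coordinates]
    simp [ofInt_intMultiple]
  have h9 : (9 : F) ≠ 0 := by
    rw [show (9 : F) = 3 * 3 by norm_num]
    exact mul_ne_zero h3 h3
  have h3' : IsIntegralMultiple (productFactor 3) (productCoordinates 3) (axisD F) := by
    have hc : ((productFactor 3 : ℤ) : F) = 9 := by simp [productFactor]
    refine ⟨hc ▸ h9, ?_⟩
    have hw : productCoordinates 3 =
        coordinates 1 4 4 (intMultiple 4 4) (intMultiple 2 3) (intMultiple 2 6) :=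
      funext (by decide +kernel)
    rw [hc, axisD, one_div, smul_inv_smul₀ h9, hw, ofCoordinates_intCast_coordinates]
    simp [ofInt_intMultiple]
  have h4' := h0'.mul h2 h1' (n := productFactor 4) (w := productCoordinates 4)
    (by decide) (by decide +kernel)
  have h5' := h0'.mul h2 h2' (n := productFactor 5) (w := productCoordinates 5)
    (by decide) (by decide +kernel)
  have h6' := h0'.mul h2 h3' (n := productFactor 6) (w := productCoordinates 6)
    (by decide) (by decide +kernel)
  have h7' := h1'.mul h2 h2' (n := productFactor 7) (w := productCoordinates 7)
    (by decide) (by decide +kernel)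
  have h8' := h1'.mul h2 h3' (n := productFactor 8) (w := productCoordinates 8)
    (by decide) (by decide +kernel)
  have h9' := h2'.mul h2 h3' (n := productFactor 9) (w := productCoordinates 9)
    (by decide) (by decide +kernel)
  have h10' := h0'.mul h2 h7' (n := productFactor 10) (w := productCoordinates 10)
    (by decide) (by decide +kernel)
  have h11' := h1'.mul h2 h5' (n := productFactor 11) (w := productCoordinates 11)
    (by decide) (by decide +kernel)
  have h12' := h2'.mul h2 h4' (n := productFactor 12) (w := productCoordinates 12)
    (by decide) (by decide +kernel)
  have h13' := h0'.mul h2 h8' (n := productFactor 13) (w := productCoordinates 13)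
    (by decide) (by decide +kernel)
  have h14' := h0'.mul h2 h9' (n := productFactor 14) (w := productCoordinates 14)
    (by decide) (by decide +kernel)
  have h15' := h1'.mul h2 h6' (n := productFactor 15) (w := productCoordinates 15)
    (by decide) (by decide +kernel)
  have h16' := h1'.mul h2 h9' (n := productFactor 16) (w := productCoordinates 16)
    (by decide) (by decide +kernel)
  have h17' := h2'.mul h2 h6' (n := productFactor 17) (w := productCoordinates 17)
    (by decide) (by decide +kernel)
  have h18' := h2'.mul h2 h8' (n := productFactor 18) (w := productCoordinates 18)
    (by decide) (by decide +kernel)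
  have h19' := h4'.mul h2 h9' (n := productFactor 19) (w := productCoordinates 19)
    (by decide) (by decide +kernel)
  have h20' := h5'.mul h2 h8' (n := productFactor 20) (w := productCoordinates 20)
    (by decide) (by decide +kernel)
  have h21' := h3'.mul h2 h10' (n := productFactor 21) (w := productCoordinates 21)
    (by decide) (by decide +kernel)
  have h22' := h3'.mul h2 h11' (n := productFactor 22) (w := productCoordinates 22)
    (by decide) (by decide +kernel)
  have h23' := h0'.mul h2 h16' (n := productFactor 23) (w := productCoordinates 23)
    (by decide) (by decide +kernel)
  have h24' := h4'.mul h2 h17' (n := productFactor 24) (w := productCoordinates 24)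
    (by decide) (by decide +kernel)
  have h25' := h4'.mul h2 h18' (n := productFactor 25) (w := productCoordinates 25)
    (by decide) (by decide +kernel)
  have h26' := h5'.mul h2 h16' (n := productFactor 26) (w := productCoordinates 26)
    (by decide) (by decide +kernel)
  fin_cases j
  exacts [h0', h1', h2', h3', h4', h5', h6', h7', h8', h9', h10', h11', h12',
    h13', h14', h15', h16', h17', h18', h19', h20', h21', h22', h23', h24', h25',
    h26']

theorem linearIndependent_products (h2 : (2 : F) ≠ 0) (h3 : (3 : F) ≠ 0) :
    LinearIndependent F (products (axisA F) (axisB F) (axisC F) (axisD F)) := by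
  set M : Matrix (Fin 27) (Fin 27) F := productCoordinates.map (Int.castRingHom F) with hM
  have hinv : productCoordinatesInverse.map (Int.castRingHom F) * M = (16 : F) • 1 := by
    rw [hM, ← Matrix.map_mul, productCoordinatesInverse_mul]
    ext j k
    simp only [Matrix.map_apply, Matrix.smul_apply, Matrix.one_apply, smul_eq_mul]
    split_ifs <;> simp
  have hc : (16 : F) ≠ 0 := by
    rw [show (16 : F) = 2 ^ 4 by norm_num]
    exact pow_ne_zero _ h2
  have hunit : IsUnit M := by
    refine IsUnit.of_mul_eq_one_right
      ((16 : F)⁻¹ • productCoordinatesInverse.map (Int.castRingHom F)) ?_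
    rw [Matrix.smul_mul, hinv, inv_smul_smul₀ hc]
  have hrow := (Matrix.linearIndependent_rows_iff_isUnit.2 hunit).map' (ofCoordinates F)
    (LinearMap.ker_eq_bot.2 (ofCoordinates_bijective h2).injective)
  have hfactor := fun j => (isIntegralMultiple_products h2 h3 j).ne_zero
  -- Each product is a nonzero multiple of the element with coordinates a row of `M`. Here 3 must be
  -- invertible, because of the factor 9 from `d`; for the rows themselves `2 ≠ 0` suffices.
  have hproducts : products (axisA F) (axisB F) (axisC F) (axisD F) =
      (fun j => (Units.mk0 _ (hfactor j))⁻¹) • (ofCoordinates F ∘ M.row) := by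
    funext j
    rw [Pi.smul_apply', eq_inv_smul_iff, Units.smul_def]
    exact (isIntegralMultiple_products h2 h3 j).smul_eq
  rw [hproducts]
  exact hrow.units_smul _

variable (F) in
/-- The basis of the Albert algebra that consists of products of the four axes. -/
theorem exists_basis_products (h2 : (2 : F) ≠ 0) (h3 : (3 : F) ≠ 0) :
    ∃ B : Module.Basis (Fin 27) F (AlbertAlgebra F),
      ⇑B = products (axisA F) (axisB F) (axisC F) (axisD F) :=
  ⟨basisOfLinearIndependentOfCardEqFinrank (linearIndependent_products h2 h3)
    (by rw [finrank_eq h2, Fintype.card_fin]), coe_basisOfLinearIndependentOfCardEqFinrank _ _⟩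

theorem adjoin_axes (h2 : (2 : F) ≠ 0) (h3 : (3 : F) ≠ 0) :
    NonUnitalAlgebra.adjoin F ({axisA F, axisB F, axisC F, axisD F} : Set (AlbertAlgebra F)) =
      ⊤ := by
  set S := NonUnitalAlgebra.adjoin F
    ({axisA F, axisB F, axisC F, axisD F} : Set (AlbertAlgebra F)) with hS
  have ha : axisA F ∈ S := NonUnitalAlgebra.mem_adjoin_of_mem F (by simp)
  have hb : axisB F ∈ S := NonUnitalAlgebra.mem_adjoin_of_mem F (by simp)
  have hc : axisC F ∈ S := NonUnitalAlgebra.mem_adjoin_of_mem F (by simp)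
  have hd : axisD F ∈ S := NonUnitalAlgebra.mem_adjoin_of_mem F (by simp)
  have hmem : ∀ j, products (axisA F) (axisB F) (axisC F) (axisD F) j ∈ S := by
    intro j
    fin_cases j <;> simp only [products] <;> repeat first | assumption | apply mul_mem
  obtain ⟨B, hB⟩ := exists_basis_products F h2 h3
  refine eq_top_iff.2 fun X _ => ?_
  change X ∈ S.toSubmodule
  have hspan : Submodule.span F (Set.range B) ≤ S.toSubmodule := by
    rw [hB, Submodule.span_le]
    rintro _ ⟨j, rfl⟩
    exact hmem j
  exact hspan (B.span_eq ▸ Submodule.mem_top)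

theorem trace_smul_mk (c d e f : F) (x y z : Octonion F) :
    trace (c • mk d e f x y z) = ofField (c * (d + e + f)) := by
  rw [trace, map_smul, toMatrix_mk, Matrix.trace_fin_three]
  simp [smul_ofField, ofField_add, mul_add]


end Products

end AlbertAlgebra

open AlbertAlgebra in
/-- Over a field of characteristic different from 2 and 3, the 27-dimensional Albert algebra is a
primitive axial algebra of Jordan type 1/2, generated by the four trace-one primitive axes
`a`, `b`, `c`, `d`, and the 27 listed products of these form a basis. -/
theorem mainTheorem4 (F : Type*) [Field F] (h2 : ringChar F ≠ 2) (h3 : ringChar F ≠ 3) :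
    Module.finrank F (AlbertAlgebra F) = 27 ∧
    (∀ e ∈ ({AlbertAlgebra.axisA F, AlbertAlgebra.axisB F, AlbertAlgebra.axisC F,
        AlbertAlgebra.axisD F} : Set (AlbertAlgebra F)), e * e = e ∧ e.trace = 1) ∧
    Axial.IsGeneratingAxes (1 / 2 : F)
      ({AlbertAlgebra.axisA F, AlbertAlgebra.axisB F, AlbertAlgebra.axisC F,
        AlbertAlgebra.axisD F} : Set (AlbertAlgebra F)) ∧
    Axial.IsPrimitiveAxialAlgebra (AlbertAlgebra F) (1 / 2 : F) ∧
    ∃ B : Module.Basis (Fin 27) F (AlbertAlgebra F),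
      ⇑B = AlbertAlgebra.products (AlbertAlgebra.axisA F) (AlbertAlgebra.axisB F)
        (AlbertAlgebra.axisC F) (AlbertAlgebra.axisD F) := by
  have hF2 : (2 : F) ≠ 0 := Ring.two_ne_zero h2
  have hF3 : (3 : F) ≠ 0 := by
    intro h
    have h' := ringChar.dvd (R := F) (x := 3) (by exact_mod_cast h)
    rcases (Nat.dvd_prime Nat.prime_three).1 h' with h1 | h1
    · exact CharP.ringChar_ne_one h1
    · exact h3 h1
  have hF9 : (9 : F) ≠ 0 := by
    rw [show (9 : F) = 3 * 3 by norm_num]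
    exact mul_ne_zero hF3 hF3
  have hrank : ∀ e ∈ ({axisA F, axisB F, axisC F, axisD F} : Set (AlbertAlgebra F)),
      Axial.IsRankOneIdempotent F e := by
    rintro e (rfl | rfl | rfl | rfl)
    exacts [isRankOneIdempotent_axisA hF2, isRankOneIdempotent_axisB hF2,
      isRankOneIdempotent_axisC hF2, isRankOneIdempotent_axisD hF2 hF3]
  have htrace : ∀ e ∈ ({axisA F, axisB F, axisC F, axisD F} : Set (AlbertAlgebra F)),
      e.trace = 1 := by
    have hone : (1 : Octonion F) = Octonion.ofField 1 := rfl
    rintro e (rfl | rfl | rfl | rfl)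
    all_goals
      first | rw [axisA] | rw [axisB] | rw [axisC] | rw [axisD]
      rw [trace_smul_mk, hone]
      congr 1
      field_simp
      norm_num
  have hgen : Axial.IsGeneratingAxes (1 / 2 : F)
      ({axisA F, axisB F, axisC F, axisD F} : Set (AlbertAlgebra F)) :=
    { eta_ne_zero := one_div_ne_zero hF2
      eta_ne_one := fun h => by
        have : (2 : F) = 1 := by rwa [one_div, inv_eq_one] at h
        exact one_ne_zero (α := F) (by linear_combination this)
      primitive := fun e he => (hrank e he).isPrimitiveAxis
      fusion := fun e he => (hrank e he).hasJordanTypeFusion hF2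
      generates := adjoin_axes hF2 hF3 }
  exact ⟨finrank_eq hF2, fun e he => ⟨(hrank e he).idempotent, htrace e he⟩, hgen, ⟨_, hgen⟩,
    exists_basis_products F hF2 hF3⟩
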